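/- **Concatenation of AMD and dual-AMD.** Let $X$ be a real reflexive Banach space with norm $\|\cdot\|$ and dual $(X^*,\|\cdot\|_*)$, and identify $X^{**}=X$. Let $f\colon X\to\mathbb{R}$ be convex and $L$-smooth (differentiable with $\|\nabla f(x)-\nabla f(y)\|_*\le L\|x-y\|$), and let $\phi,\psi\colon X\to\mathbb{R}\cup\{\pm\infty\}$ be convex, closed and proper, $\phi$ being $\sigma_1$-strongly convex and $\psi$ $\sigma_2$-strongly convex, where $L,\sigma_1,\sigma_2>0$ and $h$ is called $\sigma$-strongly convex if $h(y)\ge h(x)+\langle g,y-x\rangle+\frac{\sigma}{2}\|y-x\|^2$ for all $x,y\in X$ and all $g\in\partial h(x)$. Let $h^*(u)=\sup_{x\in X}\{\langle u,x\rangle-h(x)\}$, and let $D_h(x,x')=h(x)-h(x')-\langle\nabla h(x'),x-x'\rangle$ if $h(x)<\infty$ and $h$ is differentiable at $x'$ (finite near $x'$ with $\langle \nabla h(x'),v\rangle=\lim_{\varepsilon\to0}\frac{h(x'+\varepsilon v)-h(x')}{\varepsilon}$ for all $v$ and some $\nabla h(x')\in X^*$), and $D_h(x,x')=\infty$ otherwise.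 Assume that $\psi^*(0)=0$, that $0$ is the unique minimizer of $\psi^*$, and that there is an $x_\star\in\operatorname{argmin}_X f$ with $\phi(x_\star)<\infty$. Let $N\ge1$, and let real numbers $\theta_i$ satisfy $\theta_i=0$ for $i<0$, $0<\theta_0\le\theta_1\le\dots\le\theta_N=\theta_{N-1}$, and $\theta_i^2-\theta_i\le\theta_{i-1}^2$ for $0\le i\le N-1$. *AMD.* Given $y_0\in X^*$, let $x_0=\nabla\phi^*(y_0)$ and, for $k=0,\dots,N-1$, $$y_{k+1}=y_k-\tfrac{\sigma_1}{L}(\theta_k^2-\theta_{k-1}^2)\nabla f(x_k),$$ $$x_{k+1}=\tfrac{\theta_k^2}{\theta_{k+1}^2}x_k+\tfrac{\theta_{k+1}^2-\theta_k^2}{\theta_{k+1}^2}\nabla\phi^*(y_{k+1})+\tfrac{\theta_k^2-\theta_{k-1}^2}{\theta_{k+1}^2}\bigl(\nabla\phi^*(y_{k+1})-\nabla\phi^*(y_k)\bigr).$$ *dual-AMD.* Let $q_0=x_N$, $g_0=\frac{1}{\theta_N^2}\nabla f(q_0)$, $r_0=\frac{\theta_N^2-\theta_{N-2}^2}{\theta_N^2}\nabla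 f(q_0)$ and, for $k=0,\dots,N-1$, $$q_{k+1}=q_k-\tfrac{\sigma_2}{L}(\theta_{N-k-1}^2-\theta_{N-k-2}^2)\nabla\psi^*(r_k),\qquad g_{k+1}=g_k+\tfrac{1}{\theta_{N-k-1}^2}\bigl(\nabla f(q_{k+1})-\nabla f(q_k)\bigr),$$ $$r_{k+1}=r_k+(\theta_{N-k-1}^2-\theta_{N-k-2}^2)(g_{k+1}-g_k)+(\theta_{N-k-2}^2-\theta_{N-k-3}^2)g_{k+1}.$$ Put $x_{2N}=q_N$. Then $\phi^*$ and $\psi^*$ are finite and differentiable on all of $X^*$, with gradients in $X$, so that both methods are well defined, and $$\psi^*(\nabla f(x_{2N}))\le\frac{L}{\sigma_2\theta_N^2}\bigl(f(x_N)-f(x_\star)\bigr)\le\frac{L^2D_\phi(x_\star,x_0)}{\sigma_1\sigma_2\theta_N^4}.$$ If moreover $\theta_i^2-\theta_i=\theta_{i-1}^2$ for $0\le i\le N-1$, then the right-hand side is at most $C\,\frac{L^2D_\phi(x_\star,x_0)}{\sigma_1\sigma_2N^4}$ with an absolute constant $C$, i.e. it is $\mathcal{O}\bigl(L^2D_\phi(x_\star,x_0)/(\sigma_1\sigma_2N^4)\bigr)$.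 -/

import Mathlib

open Set Filter Topology

noncomputable section

namespace MirrorDescent

variable {X : Type*} [NormedAddCommGroup X] [NormedSpace ℝ X]

/-- Reflexivity: the canonical embedding of `X` into its bidual is onto. -/
def IsReflexiveSpace (X : Type*) [NormedAddCommGroup X] [NormedSpace ℝ X] : Prop :=
  Function.Surjective (NormedSpace.inclusionInDoubleDual ℝ X)

/-- `h` is convex, closed (its epigraph is closed in `X × ℝ`) and proper. -/
structure IsCCP (h : X → EReal) : Prop where
  convex : ∀ x y : X, ∀ t : ℝ, 0 < t → t < 1 →
    h (t • x + (1 - t) • y) ≤ (t : EReal) * h x + ((1 - t : ℝ) : EReal) * h y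
  closed : IsClosed {p : X × ℝ | h p.1 ≤ (p.2 : EReal)}
  ne_bot : ∀ x, h x ≠ ⊥
  exists_lt_top : ∃ x, h x < ⊤

/-- `g` is a subgradient of `h` at `x`. -/
def IsSubgradientAt (h : X → EReal) (g : StrongDual ℝ X) (x : X) : Prop :=
  ∀ y, h x + ((g (y - x) : ℝ) : EReal) ≤ h y

/-- `σ`-strong convexity with respect to the norm of `X`, expressed with all the subgradients. -/
def IsStronglyConvex (h : X → EReal) (σ : ℝ) : Prop :=
  ∀ (x : X) (g : StrongDual ℝ X), IsSubgradientAt h g x →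
    ∀ y, h x + ((g (y - x) + σ / 2 * ‖y - x‖ ^ 2 : ℝ) : EReal) ≤ h y

/-- `L`-smoothness of a real-valued function: differentiable with `L`-Lipschitz gradient, the dual
space carrying the dual norm. -/
def IsSmoothWith (f : X → ℝ) (L : ℝ) : Prop :=
  Differentiable ℝ f ∧ ∀ x y, ‖fderiv ℝ f x - fderiv ℝ f y‖ ≤ L * ‖x - y‖

/-- `h` is finite near `x`, and `g` is its gradient at `x`:
`⟨g, v⟩ = lim_{ε → 0} (h (x + ε v) - h x) / ε` for every direction `v`. -/
def HasGradAt (h : X → EReal) (g : StrongDual ℝ X) (x : X) : Prop :=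
  (∀ᶠ z in 𝓝 x, h z ≠ ⊤ ∧ h z ≠ ⊥) ∧
    ∀ v : X, HasLineDerivAt ℝ (fun z => (h z).toReal) (g v) x v

/-- The convex conjugate `h*(u) = sup_x (⟨u, x⟩ - h x)`. -/
def conj (h : X → EReal) (u : StrongDual ℝ X) : EReal :=
  ⨆ x : X, (((u x : ℝ) : EReal) - h x)

/-- The Bregman divergence `D_h(x, x')`. -/
def bregman (h : X → EReal) (x x' : X) : EReal :=
  open Classical in
  if H : h x < ⊤ ∧ ∃ g : StrongDual ℝ X, HasGradAt h g x' then
    h x - h x' - ((H.2.choose (x - x') : ℝ) : EReal)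
  else ⊤

/-- `x : X`, seen as an element of the bidual, is the gradient of `h*` at `y`. -/
def HasConjGradAt (h : X → EReal) (x : X) (y : StrongDual ℝ X) : Prop :=
  HasGradAt (conj h) (NormedSpace.inclusionInDoubleDual ℝ X x) y

/-- `∇h*(y)` as a point of `X` (with the dummy value `0` where there is no such gradient). -/
def conjGrad (h : X → EReal) (y : StrongDual ℝ X) : X :=
  open Classical in
  if H : ∃ x : X, HasConjGradAt h x y then H.choose else 0

/-- Admissible parameters `θ_i` for `N` steps; `θ_i = 0` for negative `i`. -/
structure IsAdmissible (N : ℕ) (θ : ℤ → ℝ) : Prop where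
  zero_of_neg : ∀ i : ℤ, i < 0 → θ i = 0
  pos_zero : 0 < θ 0
  mono : ∀ i : ℤ, 0 ≤ i → i < N → θ i ≤ θ (i + 1)
  growth : ∀ i : ℤ, 0 ≤ i → i < N → θ i ^ 2 - θ i ≤ θ (i - 1) ^ 2
  last : θ N = θ ((N : ℤ) - 1)

/-- The pair `(x_k, y_k)` of iterates of accelerated mirror descent (AMD) for `f` with
distance-generating function `φ` and starting point `y₀`, `x₀ = ∇φ*(y₀)`. -/
def amd (f : X → ℝ) (φ : X → EReal) (L σ : ℝ) (θ : ℤ → ℝ) (y₀ : StrongDual ℝ X) :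
    ℕ → X × StrongDual ℝ X
  | 0 => (conjGrad φ y₀, y₀)
  | k + 1 =>
    let x := (amd f φ L σ θ y₀ k).1
    let y := (amd f φ L σ θ y₀ k).2
    let y' := y - (σ / L * (θ k ^ 2 - θ ((k : ℤ) - 1) ^ 2)) • fderiv ℝ f x
    let x' := (θ k ^ 2 / θ ((k : ℤ) + 1) ^ 2) • x
      + ((θ ((k : ℤ) + 1) ^ 2 - θ k ^ 2) / θ ((k : ℤ) + 1) ^ 2) • conjGrad φ y'
      + ((θ k ^ 2 - θ ((k : ℤ) - 1) ^ 2) / θ ((k : ℤ) + 1) ^ 2) • (conjGrad φ y' - conjGrad φ y)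
    (x', y')

/-- The triple `(q_k, g_k, r_k)` of iterates of the `N`-step dual accelerated mirror descent
(dual-AMD) for `f` with distance-generating function `ψ` and starting point `q₀`,
`g₀ = ∇f(q₀) / θ_N²`, `r₀ = (θ_N² - θ_{N-2}²) / θ_N² ∇f(q₀)`. -/
def dualAMD (f : X → ℝ) (ψ : X → EReal) (L σ : ℝ) (N : ℕ) (θ : ℤ → ℝ) (q₀ : X) :
    ℕ → X × StrongDual ℝ X × StrongDual ℝ X
  | 0 => (q₀, (1 / θ N ^ 2) • fderiv ℝ f q₀,
      ((θ N ^ 2 - θ ((N : ℤ) - 2) ^ 2) / θ N ^ 2) • fderiv ℝ f q₀)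
  | k + 1 =>
    let q := (dualAMD f ψ L σ N θ q₀ k).1
    let g := (dualAMD f ψ L σ N θ q₀ k).2.1
    let r := (dualAMD f ψ L σ N θ q₀ k).2.2
    let a := θ ((N : ℤ) - k - 1) ^ 2
    let b := θ ((N : ℤ) - k - 2) ^ 2
    let c := θ ((N : ℤ) - k - 3) ^ 2
    let q' := q - (σ / L * (a - b)) • conjGrad ψ r
    let g' := g + (1 / a) • (fderiv ℝ f q' - fderiv ℝ f q)
    let r' := r + (a - b) • (g' - g) + (b - c) • g'
    (q', g', r')

end MirrorDescent

end

open MirrorDescent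

noncomputable section

namespace MirrorDescent

variable {X : Type*} [NormedAddCommGroup X] [NormedSpace ℝ X]

/-! Strong convexity makes `h - u` coercive, so by reflexivity it attains its minimum for every `u`;
the minimizer `Z u` is `∇h*(u)`, and strong convexity there gives the dual estimate `h*(v) + ⟨u - v,
Z v⟩ + σ/2 ‖Z u - Z v‖² ≤ h*(u)` (`IsStronglyConvex.exists_conj`). Each method then has a
nonincreasing energy (`amd_energy_le`, `dualAMD_energy_le`). The cross terms pair a difference of
gradients of `f` with a difference of mirror points; Young's inequality absorbs them into the gain
from cocoercivity and that from the dual estimate, as the growth condition on `θ` permits. At the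
last step of AMD, `θ_N = θ_{N-1}` removes the linear term and Fenchel–Young leaves the Bregman
divergence. At the last step of dual-AMD, `r_N = ∇f(q_N)`, so the energy with comparison point `q_N`
is a multiple of `ψ*(∇f(q_N))`, bounded by the decrease of `f`. Chaining the two bounds gives the
factor `θ_N⁻⁴`, and `θ_N ≥ N/2` for the standard parameters. -/

/-! ### The direct method in a reflexive space. -/

theorem IsReflexiveSpace.isCompact_toWeakSpace_image (hX : IsReflexiveSpace X) {s : Set X}
    (hc : Convex ℝ s) (hcl : IsClosed s) (hb : Bornology.IsBounded s) :
    IsCompact (toWeakSpace ℝ X '' s) := by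
  have h := NormedSpace.isCompact_closure_of_isBounded ℝ X (toWeakSpace ℝ X '' s)
    (by rwa [(toWeakSpace ℝ X).injective.preimage_image]) (by
      intro ξ _
      obtain ⟨x, hx⟩ := hX (WeakDual.toStrongDual ξ)
      refine ⟨toWeakSpace ℝ X x, ?_⟩
      exact WeakDual.toStrongDual.injective hx)
  rwa [← hc.toWeakSpace_closure ℝ, hcl.closure_eq] at h

/-- On a reflexive space, a linear functional attains its minimum over a closed convex epigraph
which grows quadratically. -/
theorem IsReflexiveSpace.exists_isMinOn_epigraph (hX : IsReflexiveSpace X) {E : Set (X × ℝ)}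
    (hconv : Convex ℝ E) (hcl : IsClosed E)
    (hup : ∀ x t s, (x, t) ∈ E → t ≤ s → (x, s) ∈ E) (hne : E.Nonempty)
    {g : StrongDual ℝ X} {c σ : ℝ} (hσ : 0 < σ)
    (hE : ∀ x t, (x, t) ∈ E → c + g x + σ / 2 * ‖x‖ ^ 2 ≤ t) (u : StrongDual ℝ X) :
    ∃ x t, (x, t) ∈ E ∧ ∀ y s, (y, s) ∈ E → t - u x ≤ s - u y := by
  set V : Set ℝ := (fun p : X × ℝ => p.2 - u p.1) '' E
  have hlow : ∀ x t, (x, t) ∈ E → c - ‖g - u‖ * ‖x‖ + σ / 2 * ‖x‖ ^ 2 ≤ t - u x := by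
    intro x t hx
    have h1 := hE x t hx
    have h2 : |(g - u) x| ≤ ‖g - u‖ * ‖x‖ := (g - u).le_opNorm x
    have h3 := neg_abs_le ((g - u) x)
    simp only [sub_apply] at h2 h3
    linarith
  have hbdd : BddBelow V := by
    refine ⟨c - ‖g - u‖ ^ 2 / (2 * σ), ?_⟩
    rintro _ ⟨⟨x, t⟩, hx, rfl⟩
    have h1 := hlow x t hx
    have h2 : 0 ≤ (‖g - u‖ - σ * ‖x‖) ^ 2 / (2 * σ) := by positivity
    have h3 : (‖g - u‖ - σ * ‖x‖) ^ 2 / (2 * σ)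
        = ‖g - u‖ ^ 2 / (2 * σ) - ‖g - u‖ * ‖x‖ + σ / 2 * ‖x‖ ^ 2 := by
      field_simp; ring
    dsimp only
    linarith
  have hVne : V.Nonempty := hne.image _
  set m := sInf V
  -- Sublevel sets above the infimum `m` are nested and weakly compact; a common point, with
  -- closedness of `E` as `M ↓ m`, is a minimizer.
  let S : Ioi m → Set X := fun M => {x | (x, M.1 + u x) ∈ E}
  have hSne : ∀ M, (S M).Nonempty := by
    rintro ⟨M, hM⟩
    obtain ⟨_, ⟨⟨x, t⟩, hx, rfl⟩, hlt⟩ := exists_lt_of_csInf_lt hVne hM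
    refine ⟨x, hup x t _ hx ?_⟩
    dsimp only at hlt ⊢
    linarith
  have hSmono : ∀ M M' : Ioi m, M.1 ≤ M'.1 → S M ⊆ S M' := by
    intro M M' h x hx
    exact hup x _ _ hx (by linarith)
  have hSconv : ∀ M, Convex ℝ (S M) := by
    intro M x hx y hy a b ha hb hab
    have := hconv hx hy ha hb hab
    have e : a • (x, M.1 + u x) + b • (y, M.1 + u y)
        = (a • x + b • y, M.1 + u (a • x + b • y)) := by
      ext
      · simp
      · simp
        linear_combination M.1 * hab
    rwa [e] at this
  have hScl : ∀ M, IsClosed (S M) := by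
    intro M
    exact hcl.preimage (by fun_prop : Continuous fun x => (x, M.1 + u x))
  have hSb : ∀ M, Bornology.IsBounded (S M) := by
    intro M
    rw [isBounded_iff_forall_norm_le]
    -- Beyond this radius the quadratic term beats the linear one; the `+ 1` forces `‖x‖ ≥ 1`, so
    -- that `|M - c|` is dominated by `|M - c| * ‖x‖`.
    refine ⟨2 * (‖g - u‖ + |M.1 - c|) / σ + 1, fun x hx => ?_⟩
    have h1 := hlow x _ hx
    by_contra! hlt
    have h4 := le_abs_self (M.1 - c)
    have h5 : 2 * (‖g - u‖ + |M.1 - c|) < σ * ‖x‖ := by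
      have : 2 * (‖g - u‖ + |M.1 - c|) / σ < ‖x‖ := by linarith
      rw [div_lt_iff₀ hσ] at this
      linarith
    have h6 : 1 ≤ ‖x‖ := by
      have : 0 ≤ 2 * (‖g - u‖ + |M.1 - c|) / σ := by positivity
      linarith
    nlinarith [abs_nonneg (M.1 - c), norm_nonneg (g - u)]
  have hK : ∀ M, IsCompact (toWeakSpace ℝ X '' S M) := fun M =>
    hX.isCompact_toWeakSpace_image (hSconv M) (hScl M) (hSb M)
  have : Nonempty (Ioi m) := ⟨⟨m + 1, by simp⟩⟩
  obtain ⟨w, hw⟩ := IsCompact.nonempty_iInter_of_directed_nonempty_isCompact_isClosed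
    (fun M => toWeakSpace ℝ X '' S M)
    (by
      intro M M'
      rcases le_total M.1 M'.1 with h | h
      · exact ⟨M, subset_rfl, image_mono (hSmono _ _ h)⟩
      · exact ⟨M', image_mono (hSmono _ _ h), subset_rfl⟩)
    (fun M => (hSne M).image _) hK (fun M => by
      rw [← (hScl M).closure_eq, (hSconv M).toWeakSpace_closure ℝ]
      exact isClosed_closure)
  set x : X := (toWeakSpace ℝ X).symm w
  have hx : ∀ M, m < M → (x, M + u x) ∈ E := by
    intro M hM
    obtain ⟨y, hy, hyw⟩ := mem_iInter.1 hw ⟨M, hM⟩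
    have : x = y := by simp [x, ← hyw]
    rw [this]
    exact hy
  refine ⟨x, m + u x, ?_, fun y s hy => ?_⟩
  · have hc : Tendsto (fun M : ℝ => (x, M + u x)) (𝓝[>] m) (𝓝 (x, m + u x)) :=
      ((by fun_prop : Continuous fun M : ℝ => (x, M + u x)).tendsto m).mono_left
        nhdsWithin_le_nhds
    exact hcl.mem_of_tendsto hc (eventually_mem_nhdsWithin.mono hx)
  · have : m ≤ s - u y := csInf_le hbdd ⟨(y, s), hy, rfl⟩
    linarith

theorem strongDual_prod_apply (F : StrongDual ℝ (X × ℝ)) (x : X) (t : ℝ) :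
    F (x, t) = F.comp (.inl ℝ X ℝ) x + F (0, 1) * t := by
  have h : ((x, t) : X × ℝ) = (x, 0) + t • (0, 1) := by simp
  rw [h, map_add, map_smul]
  simp [mul_comm]

/-! ### Existence of subgradients. -/

variable {h : X → EReal}

theorem IsCCP.convex_epigraph (hh : IsCCP h) : Convex ℝ {p : X × ℝ | h p.1 ≤ (p.2 : EReal)} := by
  rw [convex_iff_forall_pos]
  rintro ⟨x, t⟩ hx ⟨y, s⟩ hy a b ha hb hab
  obtain rfl : b = 1 - a := by linarith
  simp only [mem_ofPred_eq, Prod.smul_mk, Prod.mk_add_mk] at hx hy ⊢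
  refine (hh.convex x y a ha (by linarith)).trans ?_
  rw [smul_eq_mul, smul_eq_mul, EReal.coe_add, EReal.coe_mul, EReal.coe_mul]
  gcongr

theorem IsCCP.exists_coe (hh : IsCCP h) {x : X} (hx : h x < ⊤) : ∃ p : ℝ, h x = p :=
  ⟨(h x).toReal, (EReal.coe_toReal hx.ne (hh.ne_bot x)).symm⟩

theorem IsSubgradientAt.lt_top {g : StrongDual ℝ X} {x : X} (hg : IsSubgradientAt h g x)
    (hh : IsCCP h) : h x < ⊤ := by
  obtain ⟨y, hy⟩ := hh.exists_lt_top
  by_contra! hx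
  have := hg y
  rw [top_le_iff.1 hx, EReal.top_add_coe] at this
  exact (this.trans_lt hy).false

theorem isSubgradientAt_of_epigraph (hh : IsCCP h) {g : StrongDual ℝ X} {x : X} {t : ℝ}
    (hx : h x ≤ t) (hmin : ∀ y (s : ℝ), h y ≤ s → t - g x ≤ s - g y) : IsSubgradientAt h g x := by
  intro y
  rcases eq_or_ne (h y) ⊤ with hy | hy
  · simp [hy]
  obtain ⟨s, hs⟩ := hh.exists_coe hy.lt_top
  have := hmin y s hs.le
  calc h x + ((g (y - x) : ℝ) : EReal) ≤ (t : EReal) + ((g (y - x) : ℝ) : EReal) := by gcongr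
    _ ≤ h y := by
      rw [hs, ← EReal.coe_add, EReal.coe_le_coe_iff, map_sub]
      linarith

theorem IsCCP.exists_affine_minorant (hh : IsCCP h) :
    ∃ (g : StrongDual ℝ X) (c : ℝ), ∀ x (t : ℝ), h x ≤ t → c + g x ≤ t := by
  obtain ⟨x₀, hx₀⟩ := hh.exists_lt_top
  obtain ⟨p, hp⟩ := hh.exists_coe hx₀
  obtain ⟨F, s, hF, hs⟩ := geometric_hahn_banach_point_closed hh.convex_epigraph hh.closed
    (x := (x₀, p - 1)) (by
      simp only [mem_ofPred_eq, hp, EReal.coe_le_coe_iff]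
      linarith)
  have h1 := hs (x₀, p) hp.le
  rw [strongDual_prod_apply] at hF h1
  -- The separated points lie over the same `x₀`, so the hyperplane is not vertical.
  have hβ : 0 < F (0, 1) := by linarith
  refine ⟨-(F (0, 1))⁻¹ • F.comp (.inl ℝ X ℝ), s / F (0, 1), fun x t hx => ?_⟩
  have h2 := hs (x, t) hx
  rw [strongDual_prod_apply] at h2
  simp only [smul_apply, smul_eq_mul]
  rw [div_add' _ _ _ hβ.ne', div_le_iff₀ hβ]
  field_simp
  linarith

theorem IsCCP.exists_isSubgradientAt_of_growth (hX : IsReflexiveSpace X) (hh : IsCCP h)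
    {g : StrongDual ℝ X} {c σ : ℝ} (hσ : 0 < σ)
    (hE : ∀ x (t : ℝ), h x ≤ t → c + g x + σ / 2 * ‖x‖ ^ 2 ≤ t) (u : StrongDual ℝ X) :
    ∃ x, IsSubgradientAt h u x := by
  obtain ⟨x₀, hx₀⟩ := hh.exists_lt_top
  obtain ⟨p, hp⟩ := hh.exists_coe hx₀
  obtain ⟨x, t, hx, hmin⟩ := hX.exists_isMinOn_epigraph hh.convex_epigraph hh.closed
    (fun x t s hx hts => le_trans hx (EReal.coe_le_coe_iff.2 hts)) ⟨(x₀, p), hp.le⟩ hσ hE u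
  exact ⟨x, isSubgradientAt_of_epigraph hh hx hmin⟩

theorem convexOn_norm_sq : ConvexOn ℝ univ fun x : X => ‖x‖ ^ 2 :=
  convexOn_univ_norm.pow (fun _ _ => norm_nonneg _) 2

/-- Strong convexity speaks only of points with a subgradient, so one such point is needed to start.
Take a minimizer of `h + ‖·‖²/2` and separate the epigraph of `h` from the open region below the
concave function `t - ‖·‖²/2`, which touches `h` there. -/
theorem IsCCP.exists_isSubgradientAt (hX : IsReflexiveSpace X) (hh : IsCCP h) :
    ∃ x u, IsSubgradientAt h u x := by
  obtain ⟨g, c, hgc⟩ := hh.exists_affine_minorant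
  obtain ⟨x₀, hx₀⟩ := hh.exists_lt_top
  obtain ⟨p₀, hp₀⟩ := hh.exists_coe hx₀
  have hsq : ∀ (x y : X) (a b : ℝ), 0 ≤ a → 0 ≤ b → a + b = 1 →
      ‖a • x + b • y‖ ^ 2 ≤ a * ‖x‖ ^ 2 + b * ‖y‖ ^ 2 := fun x y a b ha hb hab =>
    convexOn_norm_sq.2 (mem_univ x) (mem_univ y) ha hb hab
  obtain ⟨x, t, hx, hmin⟩ := hX.exists_isMinOn_epigraph
    (E := {p : X × ℝ | h p.1 ≤ ((p.2 - ‖p.1‖ ^ 2 / 2 : ℝ) : EReal)})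
    (by
      rintro ⟨x, t⟩ hx ⟨y, s⟩ hy a b ha hb hab
      have := hh.convex_epigraph (x := (x, t - ‖x‖ ^ 2 / 2)) hx
        (y := (y, s - ‖y‖ ^ 2 / 2)) hy ha hb hab
      simp only [mem_ofPred_eq, Prod.smul_mk, Prod.mk_add_mk, smul_eq_mul] at this ⊢
      refine this.trans (EReal.coe_le_coe_iff.2 ?_)
      linarith [hsq x y a b ha hb hab])
    (hh.closed.preimage
      (by fun_prop : Continuous fun p : X × ℝ => (p.1, p.2 - ‖p.1‖ ^ 2 / 2)))
    (fun x t s hx hts => le_trans hx (EReal.coe_le_coe_iff.2 (by linarith)))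
    ⟨(x₀, p₀ + ‖x₀‖ ^ 2 / 2), by simp only [mem_ofPred_eq, hp₀, add_sub_cancel_right, le_refl]⟩ (g := g) (c := c) one_pos
    (fun x t hx => by linarith [hgc x _ hx]) 0
  set p := t - ‖x‖ ^ 2 / 2 with hpdef
  obtain ⟨F, s, hFB, hFA⟩ := geometric_hahn_banach_open
    (s := {q : X × ℝ | q.2 < t - ‖q.1‖ ^ 2 / 2}) (t := {q : X × ℝ | h q.1 ≤ (q.2 : EReal)})
    (by
      rintro ⟨y, r⟩ hy ⟨z, q⟩ hz a b ha hb hab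
      simp only [mem_ofPred_eq, Prod.smul_mk, Prod.mk_add_mk, smul_eq_mul] at hy hz ⊢
      have h1 := hsq y z a b ha hb hab
      have h2 : a * r + b * q < a * (t - ‖y‖ ^ 2 / 2) + b * (t - ‖z‖ ^ 2 / 2) := by
        rcases ha.eq_or_lt with rfl | ha
        · obtain rfl : b = 1 := by linarith
          linarith
        · have := mul_lt_mul_of_pos_left hy ha
          have := mul_le_mul_of_nonneg_left hz.le hb
          linarith
      have h3 : a * t + b * t = t := by rw [← add_mul, hab, one_mul]
      linarith)
    (isOpen_lt (by fun_prop) (by fun_prop)) hh.convex_epigraph (by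
      rw [Set.disjoint_left]
      rintro ⟨y, r⟩ hy hy'
      have := hmin y (r + ‖y‖ ^ 2 / 2) (by
        simpa only [mem_ofPred_eq, add_sub_cancel_right] using hy')
      simp only [mem_ofPred_eq, zero_apply] at hy this
      linarith)
  have hA : ∀ y (r : ℝ), h y ≤ r → s ≤ F.comp (.inl ℝ X ℝ) y + F (0, 1) * r := by
    intro y r hy
    rw [← strongDual_prod_apply]
    exact hFA (y, r) hy
  have hB : ∀ ε : ℝ, 0 < ε → F.comp (.inl ℝ X ℝ) x + F (0, 1) * (p - ε) < s := by
    intro ε hε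
    rw [← strongDual_prod_apply]
    exact hFB (x, p - ε) (by simp only [mem_ofPred_eq]; linarith)
  replace hx : h x ≤ (p : EReal) := hx
  clear_value p
  have hβ : 0 < F (0, 1) := by linarith [hA x p hx, hB 1 one_pos]
  have hs : F.comp (.inl ℝ X ℝ) x + F (0, 1) * p ≤ s := by
    by_contra! hlt
    have := hB ((F.comp (.inl ℝ X ℝ) x + F (0, 1) * p - s) / F (0, 1))
      (div_pos (by linarith) hβ)
    rw [mul_sub, mul_div_cancel₀ _ hβ.ne'] at this
    linarith
  refine ⟨x, -(F (0, 1))⁻¹ • F.comp (.inl ℝ X ℝ), isSubgradientAt_of_epigraph hh hx ?_⟩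
  intro y r hy
  have h1 := hs.trans (hA y r hy)
  simp only [smul_apply, smul_eq_mul]
  rw [← mul_le_mul_iff_right₀ hβ]
  field_simp
  linarith

theorem IsStronglyConvex.exists_isSubgradientAt (hX : IsReflexiveSpace X) (hh : IsCCP h) {σ : ℝ}
    (hσ : 0 < σ) (hsc : IsStronglyConvex h σ) (u : StrongDual ℝ X) :
    ∃ x, IsSubgradientAt h u x := by
  obtain ⟨x₀, g, hg⟩ := hh.exists_isSubgradientAt hX
  obtain ⟨p, hp⟩ := hh.exists_coe (hg.lt_top hh)
  -- Recentring the quadratic growth from `x₀` to the origin costs half the modulus.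
  refine hh.exists_isSubgradientAt_of_growth hX (g := g) (c := p - g x₀ - σ / 2 * ‖x₀‖ ^ 2)
    (σ := σ / 2) (by positivity) (fun x t hx => ?_) u
  have h1 := (hsc x₀ g hg x).trans hx
  rw [hp, ← EReal.coe_add, EReal.coe_le_coe_iff, map_sub] at h1
  have h2 : ‖x‖ ^ 2 / 2 - ‖x₀‖ ^ 2 ≤ ‖x - x₀‖ ^ 2 := by
    have h3 : ‖x‖ ≤ ‖x - x₀‖ + ‖x₀‖ := by simpa using norm_add_le (x - x₀) x₀
    have h4 : ‖x‖ ^ 2 ≤ (‖x - x₀‖ + ‖x₀‖) ^ 2 := by gcongr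
    nlinarith [sq_nonneg (‖x - x₀‖ - ‖x₀‖)]
  nlinarith

/-! ### Smooth convex functions and Young's inequality. -/

theorem hasDerivAt_comp_add_smul {f : X → ℝ} (hd : Differentiable ℝ f) (x v : X) (t : ℝ) :
    HasDerivAt (fun t : ℝ => f (x + t • v)) (fderiv ℝ f (x + t • v) v) t := by
  have h1 : HasDerivAt (fun t : ℝ => x + t • v) v t := by
    simpa using ((hasDerivAt_id t).smul_const v).const_add x
  exact (hd _).hasFDerivAt.comp_hasDerivAt t h1

theorem add_fderiv_sub_le_of_convexOn {f : X → ℝ} (hf : ConvexOn ℝ univ f)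
    (hd : Differentiable ℝ f) (x y : X) : f x + fderiv ℝ f x (y - x) ≤ f y := by
  have hc : ConvexOn ℝ univ (fun t : ℝ => f (x + t • (y - x))) := by
    have := hf.comp_affineMap (AffineMap.lineMap (k := ℝ) x y)
    simpa [Function.comp_def, AffineMap.lineMap_apply, add_comm] using this
  have h := hc.le_slope_of_hasDerivAt (mem_univ 0) (mem_univ 1) one_pos
    (hasDerivAt_comp_add_smul hd x (y - x) 0)
  simp only [slope_def_field, zero_smul, one_smul, add_zero, add_sub_cancel, sub_zero, div_one] at h
  linarith

/-- The descent lemma. -/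
theorem IsSmoothWith.le_add_fderiv_add {f : X → ℝ} {L : ℝ} (hf : IsSmoothWith f L) (x v : X) :
    f (x + v) ≤ f x + fderiv ℝ f x v + L / 2 * ‖v‖ ^ 2 := by
  have hder : ∀ t : ℝ, HasDerivAt
      (fun t : ℝ => f (x + t • v) - (t * fderiv ℝ f x v + L / 2 * ‖v‖ ^ 2 * t ^ 2))
      (fderiv ℝ f (x + t • v) v - (fderiv ℝ f x v + L * ‖v‖ ^ 2 * t)) t := by
    intro t
    have h2 := ((hasDerivAt_id t).mul_const (fderiv ℝ f x v)).add
      (((hasDerivAt_id t).pow 2).const_mul (L / 2 * ‖v‖ ^ 2))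
    refine ((hasDerivAt_comp_add_smul hf.1 x v t).sub h2).congr_deriv ?_
    simp only [id_eq, Nat.cast_ofNat, Nat.add_one_sub_one, pow_one]
    ring
  have hanti := antitoneOn_of_deriv_nonpos (convex_Icc (0 : ℝ) 1)
    (fun t _ => (hder t).continuousAt.continuousWithinAt)
    (fun t _ => (hder t).differentiableAt.differentiableWithinAt) (fun t ht => by
      rw [interior_Icc] at ht
      rw [(hder t).deriv]
      have h1 := (fderiv ℝ f (x + t • v) - fderiv ℝ f x).le_opNorm v
      have h2 := hf.2 (x + t • v) x
      rw [add_sub_cancel_left, norm_smul, Real.norm_of_nonneg ht.1.le] at h2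
      have h3 := le_abs_self ((fderiv ℝ f (x + t • v) - fderiv ℝ f x) v)
      rw [Real.norm_eq_abs] at h1
      have h4 := mul_le_mul_of_nonneg_right h2 (norm_nonneg v)
      rw [sub_apply] at h3
      rw [sub_apply] at h1
      linarith)
  have := hanti (left_mem_Icc.2 zero_le_one) (right_mem_Icc.2 zero_le_one) zero_le_one
  simp at this
  linarith

/-- The conjugate of `L/2 ‖·‖²` is `‖·‖_*²/(2L)`. The dual norm need not be attained here, so each
direction `v` is optimally rescaled. -/
theorem sq_norm_le_of_forall_sub_le {p : StrongDual ℝ X} {L M : ℝ} (hL : 0 < L)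
    (h : ∀ v, p v - L / 2 * ‖v‖ ^ 2 ≤ M) : ‖p‖ ^ 2 ≤ 2 * L * M := by
  have hM : 0 ≤ M := by simpa using h 0
  have h1 : ‖p‖ ≤ √(2 * L * M) := by
    refine p.opNorm_le_bound (Real.sqrt_nonneg _) fun v => ?_
    rcases eq_or_ne v 0 with rfl | hv
    · simp
    have hv' : 0 < ‖v‖ := norm_pos_iff.2 hv
    have h2 := h ((p v / (L * ‖v‖ ^ 2)) • v)
    rw [map_smul, norm_smul, mul_pow, Real.norm_eq_abs, sq_abs, smul_eq_mul] at h2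
    have h3 : p v / (L * ‖v‖ ^ 2) * p v - L / 2 * ((p v / (L * ‖v‖ ^ 2)) ^ 2 * ‖v‖ ^ 2)
        = p v ^ 2 / (2 * L * ‖v‖ ^ 2) := by
      field_simp
      ring
    rw [h3, div_le_iff₀ (by positivity)] at h2
    rw [Real.norm_eq_abs, ← Real.sqrt_sq hv'.le, ← Real.sqrt_mul (by positivity)]
    exact Real.abs_le_sqrt (by linarith)
  calc ‖p‖ ^ 2 ≤ √(2 * L * M) ^ 2 := by gcongr
    _ = 2 * L * M := Real.sq_sqrt (by positivity)

/-- Cocoercivity of the gradient of a smooth convex function. -/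
theorem IsSmoothWith.add_fderiv_add_sq_norm_le {f : X → ℝ} {L : ℝ} (hL : 0 < L)
    (hc : ConvexOn ℝ univ f) (hf : IsSmoothWith f L) (x y : X) :
    f x + fderiv ℝ f x (y - x) + 1 / (2 * L) * ‖fderiv ℝ f y - fderiv ℝ f x‖ ^ 2 ≤ f y := by
  -- The point `y - v` is bounded above by descent from `y` and below by the tangent at `x`, for all
  -- `v`.
  have h := sq_norm_le_of_forall_sub_le (p := fderiv ℝ f y - fderiv ℝ f x) hL
    (M := f y - f x - fderiv ℝ f x (y - x)) (fun v => by
      have h1 := hf.le_add_fderiv_add y (-v)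
      have h2 := add_fderiv_sub_le_of_convexOn hc hf.1 x (y + -v)
      simp only [map_neg, map_sub, map_add, norm_neg, sub_apply] at h1 h2 ⊢
      linarith)
  have h2 : 1 / (2 * L) * ‖fderiv ℝ f y - fderiv ℝ f x‖ ^ 2
      ≤ f y - f x - fderiv ℝ f x (y - x) := by
    rw [one_div, inv_mul_le_iff₀ (by positivity)]
    exact h
  linarith

theorem mul_mul_le_add_sq {L c d T a n : ℝ} (hL : 0 < L)
    (hc : |c| ≤ n * d) (ha : 0 ≤ a) (haT : a ^ 2 ≤ T) :
    a * c ≤ T / (2 * L) * n ^ 2 + L / 2 * d ^ 2 := by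
  have h1 : a * c ≤ a * (n * d) := by
    gcongr
    exact (le_abs_self c).trans hc
  have h2 : 0 ≤ (a * n - L * d) ^ 2 / (2 * L) := by positivity
  have h3 : (a * n - L * d) ^ 2 / (2 * L)
      = a ^ 2 / (2 * L) * n ^ 2 - a * (n * d) + L / 2 * d ^ 2 := by
    field_simp
    ring
  have h4 : a ^ 2 / (2 * L) * n ^ 2 ≤ T / (2 * L) * n ^ 2 := by gcongr
  linarith

/-! ### Energy estimates. -/

section Energy

variable {f : X → ℝ} {Ψ : StrongDual ℝ X → ℝ} {Z : StrongDual ℝ X → X} {L σ : ℝ}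

/-- The energy estimate of accelerated mirror descent. -/
theorem amd_energy_le (hL : 0 < L) (hσ : 0 < σ) (hc : ConvexOn ℝ univ f) (hf : IsSmoothWith f L)
    (hΨ : ∀ u v, Ψ v + (u - v) (Z v) + σ / 2 * ‖Z u - Z v‖ ^ 2 ≤ Ψ u)
    {N : ℕ} {T a : ℕ → ℝ} {x : ℕ → X} {y : ℕ → StrongDual ℝ X} (xs : X)
    (hT : ∀ k ≤ N, 0 ≤ T k) (ha : ∀ k ≤ N, 0 ≤ a k) (haT : ∀ k < N, a k ^ 2 ≤ T k)
    (ha0 : a 0 = T 0) (hasucc : ∀ k < N, a (k + 1) = T (k + 1) - T k)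
    (hx0 : x 0 = Z (y 0))
    (hy : ∀ k < N, y (k + 1) = y k - (σ / L * a k) • fderiv ℝ f (x k))
    (hx : ∀ k < N, T (k + 1) • x (k + 1)
      = T k • x k + a (k + 1) • Z (y (k + 1)) + a k • (Z (y (k + 1)) - Z (y k))) :
    ∀ k ≤ N, T k * (f (x k) - f xs) + a k * fderiv ℝ f (x k) (xs - Z (y k))
      + L / σ * (Ψ (y k) - y k xs) ≤ L / σ * (Ψ (y 0) - y 0 xs) := by
  intro k
  induction k with
  | zero =>
    intro _
    have h := mul_le_mul_of_nonneg_left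
      (add_fderiv_sub_le_of_convexOn hc hf.1 (x 0) xs) (hT 0 (by lia))
    rw [← hx0, ha0]
    linarith
  | succ k ih =>
    intro hk
    refine le_trans ?_ (ih (by lia))
    -- `h1`–`h3` are cocoercivity, convexity towards `xs` and the dual estimate; `h4` is Young's
    -- inequality, and `h5` pairs the coupling of the iterates with the new gradient.
    have h1 := mul_le_mul_of_nonneg_left
      (hf.add_fderiv_add_sq_norm_le hL hc (x (k + 1)) (x k)) (hT k (by lia))
    have h2 := mul_le_mul_of_nonneg_left
      (add_fderiv_sub_le_of_convexOn hc hf.1 (x (k + 1)) xs) (ha (k + 1) hk)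
    have h3 := mul_le_mul_of_nonneg_left (hΨ (y k) (y (k + 1)))
      (by positivity : 0 ≤ L / σ)
    have h4 := mul_mul_le_add_sq hL
      ((fderiv ℝ f (x k) - fderiv ℝ f (x (k + 1))).le_opNorm (Z (y k) - Z (y (k + 1))))
      (ha k (by lia)) (haT k (by lia))
    have h5 := congrArg (fderiv ℝ f (x (k + 1))) (hx k (by lia))
    have hyk : ∀ v, y (k + 1) v = y k v - σ / L * a k * fderiv ℝ f (x k) v := by
      intro v
      rw [hy k (by lia)]
      simp
    have hLσ : ∀ r : ℝ, L / σ * (σ / L * a k * r) = a k * r := by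
      intro r
      field_simp
    have hLσ' : ∀ r : ℝ, L / σ * (σ / 2 * r) = L / 2 * r := by
      intro r
      field_simp
    have hLT : ∀ r : ℝ, T k * (1 / (2 * L) * r) = T k / (2 * L) * r := by
      intro r
      ring
    simp only [map_add, map_sub, map_smul, smul_eq_mul, sub_apply, hyk, mul_add, mul_sub, hLσ,
      hLσ', hLT] at h1 h2 h3 h4 h5 ⊢
    have hak := hasucc k (by lia)
    have e1 : T (k + 1) * f (x (k + 1)) = T k * f (x (k + 1)) + a (k + 1) * f (x (k + 1)) := by
      rw [hak]; ring
    have e2 : T (k + 1) * f xs = T k * f xs + a (k + 1) * f xs := by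
      rw [hak]; ring
    have e3 : T (k + 1) * fderiv ℝ f (x (k + 1)) (x (k + 1))
        = T k * fderiv ℝ f (x (k + 1)) (x (k + 1))
          + a (k + 1) * fderiv ℝ f (x (k + 1)) (x (k + 1)) := by
      rw [hak]; ring
    linarith

/-- The energy estimate of dual accelerated mirror descent. -/
theorem dualAMD_energy_le (hL : 0 < L) (hσ : 0 < σ) (hc : ConvexOn ℝ univ f)
    (hf : IsSmoothWith f L)
    (hΨ : ∀ u v, Ψ v + (u - v) (Z v) + σ / 2 * ‖Z u - Z v‖ ^ 2 ≤ Ψ u) (hΨ0 : Ψ 0 = 0)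
    {N : ℕ} {b τ : ℕ → ℝ} {q : ℕ → X} {g r : ℕ → StrongDual ℝ X} (xs : X)
    (hτ : ∀ k ≤ N, 0 < τ k) (hτmono : ∀ k < N, τ k ≤ τ (k + 1)) (hb : ∀ k ≤ N, 0 ≤ b k)
    (hbτ : ∀ k < N, b k ^ 2 * τ (k + 1) ≤ 1)
    (hg0 : g 0 = τ 0 • fderiv ℝ f (q 0)) (hr0 : r 0 = b 0 • g 0)
    (hq : ∀ k < N, q (k + 1) = q k - (σ / L * b k) • Z (r k))
    (hg : ∀ k < N, g (k + 1) = g k + τ (k + 1) • (fderiv ℝ f (q (k + 1)) - fderiv ℝ f (q k)))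
    (hr : ∀ k < N, r (k + 1) = r k + b k • (g (k + 1) - g k) + b (k + 1) • g (k + 1)) :
    ∀ k ≤ N, σ / L * (Ψ (r k) - b k * g k (Z (r k))) + τ k * (f (q k) - f xs)
      + (τ k • fderiv ℝ f (q k) - g k) (xs - q k) ≤ τ 0 * (f (q 0) - f xs) := by
  intro k
  induction k with
  | zero =>
    intro _
    have h := hΨ 0 (r 0)
    have h1 : 0 ≤ σ / 2 * ‖Z 0 - Z (r 0)‖ ^ 2 := by positivity
    have h2 : Ψ (r 0) - b 0 * g 0 (Z (r 0)) ≤ 0 := by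
      have : (0 - r 0) (Z (r 0)) = - (b 0 * g 0 (Z (r 0))) := by simp [hr0]
      linarith
    have h3 := mul_nonpos_of_nonneg_of_nonpos (by positivity : 0 ≤ σ / L) h2
    rw [← hg0, sub_self, zero_apply]
    linarith
  | succ k ih =>
    intro hk
    refine le_trans ?_ (ih (by lia))
    have h1 := mul_le_mul_of_nonneg_left
      (hf.add_fderiv_add_sq_norm_le hL hc (q (k + 1)) (q k)) (hτ (k + 1) hk).le
    have h2 := mul_le_mul_of_nonneg_left
      (add_fderiv_sub_le_of_convexOn hc hf.1 (q k) xs) (sub_nonneg.2 (hτmono k (by lia)))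
    have h3 := mul_le_mul_of_nonneg_left (hΨ (r k) (r (k + 1)))
      (by positivity : 0 ≤ σ / L)
    -- Young's inequality with `σ` in the role of `L` and `a = b k * τ (k + 1)`; multiplied by `σ /
    -- L`, its gradient term matches the cocoercivity gain.
    have h4 := mul_mul_le_add_sq hσ
      ((fderiv ℝ f (q k) - fderiv ℝ f (q (k + 1))).le_opNorm (Z (r k) - Z (r (k + 1))))
      (mul_nonneg (hb k (by lia)) (hτ (k + 1) hk).le)
      (T := τ (k + 1)) (by
        have := mul_le_mul_of_nonneg_right (hbτ k (by lia)) (hτ (k + 1) hk).le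
        linarith)
    replace h4 := mul_le_mul_of_nonneg_left h4 (by positivity : 0 ≤ σ / L)
    have hrk : ∀ v, r (k + 1) v = r k v + b k * (g (k + 1) v - g k v) + b (k + 1) * g (k + 1) v := by
      intro v
      rw [hr k (by lia)]
      simp
    have hgk : ∀ v, g (k + 1) v
        = g k v + τ (k + 1) * (fderiv ℝ f (q (k + 1)) v - fderiv ℝ f (q k) v) := by
      intro v
      rw [hg k (by lia)]
      simp
    have hqk : ∀ u : StrongDual ℝ X, u (q (k + 1)) = u (q k) - σ / L * b k * u (Z (r k)) := by
      intro u
      rw [hq k (by lia)]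
      simp
    have hσL : ∀ s : ℝ, σ / L * (τ (k + 1) / (2 * σ) * s) = τ (k + 1) * (1 / (2 * L) * s) := by
      intro s
      field_simp
    simp only [map_sub, smul_apply, smul_eq_mul, sub_apply, hrk, hgk, hqk, mul_add, hσL]
      at h1 h2 h3 h4 ⊢
    linarith

end Energy

/-! ### Conjugates, their gradients and the Bregman divergence. -/

section Conjugate

variable {h : X → EReal}

theorem IsSubgradientAt.conj_eq {u : StrongDual ℝ X} {x : X} {p : ℝ} (hs : IsSubgradientAt h u x)
    (hh : IsCCP h) (hp : h x = p) : conj h u = ((u x - p : ℝ) : EReal) := by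
  refine le_antisymm (iSup_le fun y => ?_) ?_
  · rcases eq_or_ne (h y) ⊤ with hy | hy
    · simp [hy]
    obtain ⟨s, hs'⟩ := hh.exists_coe hy.lt_top
    have := hs y
    rw [hp, hs', ← EReal.coe_add, EReal.coe_le_coe_iff, map_sub] at this
    rw [hs', ← EReal.coe_sub, EReal.coe_le_coe_iff]
    linarith
  · refine le_trans ?_ (le_iSup _ x)
    rw [hp, EReal.coe_sub]

theorem le_of_conj_eq {u : StrongDual ℝ X} {x : X} {p c : ℝ} (hp : h x = p)
    (hc : conj h u = c) : u x - p ≤ c := by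
  have : ((u x : ℝ) : EReal) - h x ≤ conj h u :=
    le_iSup (fun x => ((u x : ℝ) : EReal) - h x) x
  rwa [hp, hc, ← EReal.coe_sub, EReal.coe_le_coe_iff] at this

/-- Using the estimate in both orders, the remainder lies between `0` and `‖v - u‖²/(2σ)`. -/
theorem hasFDerivAt_of_conj_estimate {Ψ : StrongDual ℝ X → ℝ} {Z : StrongDual ℝ X → X} {σ : ℝ}
    (hσ : 0 < σ) (hΨ : ∀ u v, Ψ v + (u - v) (Z v) + σ / 2 * ‖Z u - Z v‖ ^ 2 ≤ Ψ u)
    (u : StrongDual ℝ X) :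
    HasFDerivAt Ψ (NormedSpace.inclusionInDoubleDual ℝ X (Z u)) u := by
  have hO : (fun v => Ψ v - Ψ u - (v - u) (Z u)) =O[𝓝 u] fun v => ‖v - u‖ ^ 2 := by
    refine Asymptotics.IsBigO.of_bound (1 / (2 * σ)) (Eventually.of_forall fun v => ?_)
    have h1 := hΨ v u
    have h2 := hΨ u v
    have h3 := (le_abs_self _).trans ((v - u).le_opNorm (Z v - Z u))
    have h4 : 0 ≤ σ / 2 * ‖Z v - Z u‖ ^ 2 := by positivity
    have h5 : 0 ≤ (‖v - u‖ - σ * ‖Z v - Z u‖) ^ 2 / (2 * σ) := by positivity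
    have h6 : (‖v - u‖ - σ * ‖Z v - Z u‖) ^ 2 / (2 * σ)
        = 1 / (2 * σ) * ‖v - u‖ ^ 2 - ‖v - u‖ * ‖Z v - Z u‖ + σ / 2 * ‖Z v - Z u‖ ^ 2 := by
      field_simp
      ring
    rw [norm_sub_rev (Z u)] at h2
    rw [Real.norm_of_nonneg (by linarith), Real.norm_of_nonneg (by positivity)]
    simp only [map_sub, sub_apply] at h1 h2 h3 ⊢
    linarith
  have h0 := hO.hasFDerivAt (𝕜 := ℝ) one_lt_two
  have h1 := (h0.add ((NormedSpace.inclusionInDoubleDual ℝ X (Z u)).hasFDerivAt (x := u))).add_const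
    (Ψ u - u (Z u))
  rw [zero_add] at h1
  refine h1.congr_of_eventuallyEq (Eventually.of_forall fun v => ?_)
  simp [NormedSpace.dual_def]
  ring

theorem hasConjGradAt_of_hasFDerivAt {Ψ : StrongDual ℝ X → ℝ} (hc : ∀ u, conj h u = Ψ u) {x : X}
    {u : StrongDual ℝ X} (hd : HasFDerivAt Ψ (NormedSpace.inclusionInDoubleDual ℝ X x) u) :
    HasConjGradAt h x u := by
  refine ⟨Eventually.of_forall fun v => by simp [hc], fun v => ?_⟩
  simp only [hc, EReal.toReal_coe]
  exact hd.hasLineDerivAt v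

theorem HasConjGradAt.unique {x x' : X} {u : StrongDual ℝ X} (hx : HasConjGradAt h x u)
    (hx' : HasConjGradAt h x' u) : x = x' := by
  rw [SeparatingDual.eq_iff_forall_dual_eq (R := ℝ)]
  intro v
  simpa [NormedSpace.dual_def] using (hx.2 v).unique (hx'.2 v)

theorem HasConjGradAt.conjGrad_eq {x : X} {u : StrongDual ℝ X} (hx : HasConjGradAt h x u) :
    conjGrad h u = x := by
  have H : ∃ x : X, HasConjGradAt h x u := ⟨x, hx⟩
  rw [conjGrad, dif_pos H]
  exact H.choose_spec.unique hx

/-- The conjugate of a strongly convex function on a reflexive space is finite and differentiable;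
its gradient inverts the subdifferential. -/
theorem IsStronglyConvex.exists_conj (hX : IsReflexiveSpace X) (hh : IsCCP h) {σ : ℝ}
    (hσ : 0 < σ) (hsc : IsStronglyConvex h σ) :
    ∃ Ψ : StrongDual ℝ X → ℝ, (∀ u, conj h u = Ψ u) ∧ (∀ u, IsSubgradientAt h u (conjGrad h u)) ∧
      (∀ u, HasConjGradAt h (conjGrad h u) u) ∧
      ∀ u v, Ψ v + (u - v) (conjGrad h v) + σ / 2 * ‖conjGrad h u - conjGrad h v‖ ^ 2 ≤ Ψ u := by
  choose Z hZ using hsc.exists_isSubgradientAt hX hh hσ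
  choose p hp using fun u => hh.exists_coe ((hZ u).lt_top hh)
  have hc : ∀ u, conj h u = ((u (Z u) - p u : ℝ) : EReal) := fun u => (hZ u).conj_eq hh (hp u)
  have hΨ : ∀ u v : StrongDual ℝ X, (v (Z v) - p v) + (u - v) (Z v) + σ / 2 * ‖Z u - Z v‖ ^ 2
      ≤ u (Z u) - p u := by
    intro u v
    have h1 := hsc (Z u) u (hZ u) (Z v)
    rw [hp, hp, ← EReal.coe_add, EReal.coe_le_coe_iff, norm_sub_rev, map_sub] at h1
    rw [sub_apply]
    linarith
  have hgrad : ∀ u, HasConjGradAt h (Z u) u := fun u =>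
    hasConjGradAt_of_hasFDerivAt hc (hasFDerivAt_of_conj_estimate hσ hΨ u)
  obtain rfl : conjGrad h = Z := funext fun u => (hgrad u).conjGrad_eq
  exact ⟨_, hc, hZ, hgrad, hΨ⟩

/-- On each line, `t ↦ h (x + t v) - t * u v` has a minimum at `0`. Hence the gradient chosen in
`bregman` must be the given subgradient. -/
theorem IsSubgradientAt.eq_of_hasGradAt {g u : StrongDual ℝ X} {x : X}
    (hs : IsSubgradientAt h u x) (hg : HasGradAt h g x) : g = u := by
  ext v
  have h1 : HasDerivAt (fun t : ℝ => (h (x + t • v)).toReal) (g v) 0 := hg.2 v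
  have h2 := h1.sub ((hasDerivAt_id (0 : ℝ)).mul_const (u v))
  have hcont : Tendsto (fun t : ℝ => x + t • v) (𝓝 0) (𝓝 x) := by
    have := (by fun_prop : Continuous fun t : ℝ => x + t • v).tendsto 0
    simpa using this
  have hmin : IsLocalMin ((fun t : ℝ => (h (x + t • v)).toReal) - fun t => id t * u v) 0 := by
    have hfin := hg.1.self_of_nhds
    filter_upwards [hcont.eventually hg.1] with t ht
    have h3 := hs (x + t • v)
    rw [← EReal.coe_toReal hfin.1 hfin.2, ← EReal.coe_toReal ht.1 ht.2, ← EReal.coe_add,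
      EReal.coe_le_coe_iff] at h3
    simp only [add_sub_cancel_left, map_smul, smul_eq_mul] at h3
    simp only [Pi.sub_apply, zero_smul, add_zero, id_eq, zero_mul, sub_zero]
    linarith
  have := hmin.hasDerivAt_eq_zero h2
  linarith

theorem IsSubgradientAt.bregman_eq {u : StrongDual ℝ X} {x x' : X} (hs : IsSubgradientAt h u x')
    (hh : IsCCP h) {p c : ℝ} (hp : h x = p) (hc : conj h u = c) :
    bregman h x x' = ⊤ ∨ bregman h x x' = ((p + c - u x : ℝ) : EReal) := by
  rw [bregman]
  split_ifs with H
  · right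
    rw [hs.eq_of_hasGradAt H.2.choose_spec]
    obtain ⟨p', hp'⟩ := hh.exists_coe (hs.lt_top hh)
    have := hs.conj_eq hh hp'
    rw [hc, EReal.coe_eq_coe_iff] at this
    rw [hp, hp', ← EReal.coe_sub, ← EReal.coe_sub, EReal.coe_eq_coe_iff, map_sub]
    linarith
  · exact Or.inl rfl

end Conjugate

/-! ### The parameters `θ`. -/

namespace IsAdmissible

variable {N : ℕ} {θ : ℤ → ℝ}

theorem le_succ (hθ : IsAdmissible N θ) (i : ℤ) (hi : i < N) : θ i ≤ θ (i + 1) := by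
  rcases lt_trichotomy i (-1) with h | rfl | h
  · rw [hθ.zero_of_neg i (by lia), hθ.zero_of_neg (i + 1) (by lia)]
  · rw [hθ.zero_of_neg _ (by lia)]
    exact hθ.pos_zero.le
  · exact hθ.mono i (by lia) hi

theorem pos (hθ : IsAdmissible N θ) (i : ℤ) (hi : 0 ≤ i) (hiN : i ≤ N) : 0 < θ i := by
  induction i, hi using Int.leInduction with
  | base => exact hθ.pos_zero
  | succ i hi ih => exact (ih (by lia)).trans_le (hθ.mono i hi (by lia))

theorem nonneg (hθ : IsAdmissible N θ) (i : ℤ) (hiN : i ≤ N) : 0 ≤ θ i := by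
  rcases lt_or_ge i 0 with h | h
  · exact (hθ.zero_of_neg i h).ge
  · exact (hθ.pos i h hiN).le

theorem sq_le_sq_succ (hθ : IsAdmissible N θ) (i : ℤ) (hi : i < N) : θ i ^ 2 ≤ θ (i + 1) ^ 2 :=
  pow_le_pow_left₀ (hθ.nonneg i hi.le) (hθ.le_succ i hi) 2

theorem sub_sq_nonneg (hθ : IsAdmissible N θ) (i : ℤ) (hi : i ≤ N) :
    0 ≤ θ i ^ 2 - θ (i - 1) ^ 2 := by
  have := hθ.sq_le_sq_succ (i - 1) (by lia)
  rw [sub_add_cancel] at this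
  linarith

theorem sq_sub_sq_le (hθ : IsAdmissible N θ) (i : ℤ) (hi : 0 ≤ i) (hiN : i < N) :
    (θ i ^ 2 - θ (i - 1) ^ 2) ^ 2 ≤ θ i ^ 2 :=
  pow_le_pow_left₀ (hθ.sub_sq_nonneg i hiN.le) (by linarith [hθ.growth i hi hiN]) 2

/-- The lower bound for the parameters defined by equality in the growth condition. -/
theorem half_le (hθ : IsAdmissible N θ)
    (heq : ∀ i : ℤ, 0 ≤ i → i < N → θ i ^ 2 - θ i = θ (i - 1) ^ 2) (i : ℤ) (hi : 0 ≤ i)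
    (hiN : i < N) : ((i : ℝ) + 2) / 2 ≤ θ i := by
  induction i, hi using Int.leInduction with
  | base =>
    have h1 := heq 0 le_rfl hiN
    have h2 := hθ.pos_zero
    rw [hθ.zero_of_neg (0 - 1) (by lia)] at h1
    have : θ 0 * (θ 0 - 1) = 0 := by linarith
    rcases mul_eq_zero.1 this with h | h
    · linarith
    · simp
      linarith
  | succ i hi ih =>
    have h1 := heq (i + 1) (by lia) hiN
    have h2 := hθ.pos (i + 1) (by lia) (by lia)
    have h3 := hθ.pos i hi (by lia)
    have h4 := ih (by lia)
    rw [add_sub_cancel_right] at h1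
    push_cast
    -- The recursion reads `(θ (i + 1) - 1/2)² = θ i² + 1/4`, so `θ` grows by more than `1/2` per
    -- step.
    by_contra! hlt
    have h5 : (0 : ℝ) ≤ i := by exact_mod_cast hi
    have h6 : 0 < θ i - (θ (i + 1) - 1 / 2) := by linarith
    have h7 : 0 < θ i + (θ (i + 1) - 1 / 2) := by linarith
    linarith [mul_pos h6 h7]

theorem le_two_mul_last (hθ : IsAdmissible N θ) (hN : 1 ≤ N)
    (heq : ∀ i : ℤ, 0 ≤ i → i < N → θ i ^ 2 - θ i = θ (i - 1) ^ 2) : (N : ℝ) ≤ 2 * θ N := by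
  have := hθ.half_le heq ((N : ℤ) - 1) (by lia) (by lia)
  rw [hθ.last]
  push_cast at this
  linarith

end IsAdmissible

/-! ### The bounds for the two methods. -/

section Bounds

variable {f : X → ℝ} {φ ψ : X → EReal} {L σ : ℝ} {N : ℕ} {θ : ℤ → ℝ}

theorem amd_sub_le (hL : 0 < L) (hσ : 0 < σ) (hc : ConvexOn ℝ univ f) (hf : IsSmoothWith f L)
    {Φ : StrongDual ℝ X → ℝ}
    (hΦ : ∀ u v, Φ v + (u - v) (conjGrad φ v) + σ / 2 * ‖conjGrad φ u - conjGrad φ v‖ ^ 2 ≤ Φ u)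
    (hθ : IsAdmissible N θ) (y₀ : StrongDual ℝ X) (xs : X) {p : ℝ}
    (hp : ∀ u, u xs - p ≤ Φ u) :
    θ N ^ 2 * (f (amd f φ L σ θ y₀ N).1 - f xs) ≤ L / σ * (p + Φ y₀ - y₀ xs) := by
  have h := amd_energy_le hL hσ hc hf hΦ (N := N) (T := fun k => θ k ^ 2)
    (a := fun k => θ k ^ 2 - θ ((k : ℤ) - 1) ^ 2) (x := fun k => (amd f φ L σ θ y₀ k).1)
    (y := fun k => (amd f φ L σ θ y₀ k).2) xs
    (fun k _ => sq_nonneg _) (fun k hk => hθ.sub_sq_nonneg k (by lia))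
    (fun k hk => hθ.sq_sub_sq_le k (by lia) (by lia))
    (by simp [hθ.zero_of_neg (-1) (by lia)]) (fun k _ => by simp) rfl (fun k _ => rfl)
    (fun k hk => by
      have hpos : θ ((k : ℤ) + 1) ^ 2 ≠ 0 := (pow_pos (hθ.pos (k + 1) (by lia) (by lia)) 2).ne'
      rw [amd]
      simp only [Nat.cast_add, Nat.cast_one, add_sub_cancel_right, smul_add, smul_smul,
        mul_div_cancel₀ _ hpos])
    N le_rfl
  simp only [← hθ.last, sub_self, zero_mul, add_zero] at h
  have h1 := mul_le_mul_of_nonneg_left (hp (amd f φ L σ θ y₀ N).2) (by positivity : 0 ≤ L / σ)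
  have h2 : (amd f φ L σ θ y₀ 0).2 = y₀ := rfl
  rw [h2] at h
  linarith

theorem dualAMD_conj_le (hL : 0 < L) (hσ : 0 < σ) (hc : ConvexOn ℝ univ f) (hf : IsSmoothWith f L)
    {Ψ : StrongDual ℝ X → ℝ}
    (hΨ : ∀ u v, Ψ v + (u - v) (conjGrad ψ v) + σ / 2 * ‖conjGrad ψ u - conjGrad ψ v‖ ^ 2 ≤ Ψ u)
    (hΨ0 : Ψ 0 = 0) (hN : 1 ≤ N) (hθ : IsAdmissible N θ) (q₀ : X) :
    σ / L * Ψ (fderiv ℝ f (dualAMD f ψ L σ N θ q₀ N).1)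
      ≤ 1 / θ N ^ 2 * (f q₀ - f (dualAMD f ψ L σ N θ q₀ N).1) := by
  let q : ℕ → X := fun k => (dualAMD f ψ L σ N θ q₀ k).1
  let g : ℕ → StrongDual ℝ X := fun k => (dualAMD f ψ L σ N θ q₀ k).2.1
  let r : ℕ → StrongDual ℝ X := fun k => (dualAMD f ψ L σ N θ q₀ k).2.2
  have e1 : ∀ k : ℕ, (N : ℤ) - ((k + 1 : ℕ) : ℤ) = N - k - 1 := fun k => by push_cast; ring
  have e2 : ∀ k : ℕ, (N : ℤ) - k - 1 - 1 = N - k - 2 := fun k => by ring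
  have e3 : ∀ k : ℕ, (N : ℤ) - k - 1 - 2 = N - k - 3 := fun k => by ring
  have hpos : ∀ k : ℕ, k ≤ N → 0 < θ ((N : ℤ) - k) := fun k hk => hθ.pos _ (by lia) (by lia)
  have hqs : ∀ k, q (k + 1) = q k
      - (σ / L * (θ ((N : ℤ) - k - 1) ^ 2 - θ ((N : ℤ) - k - 2) ^ 2)) • conjGrad ψ (r k) :=
    fun k => rfl
  have hgs : ∀ k, g (k + 1) = g k
      + (1 / θ ((N : ℤ) - k - 1) ^ 2) • (fderiv ℝ f (q (k + 1)) - fderiv ℝ f (q k)) :=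
    fun k => rfl
  have hrs : ∀ k, r (k + 1) = r k
      + (θ ((N : ℤ) - k - 1) ^ 2 - θ ((N : ℤ) - k - 2) ^ 2) • (g (k + 1) - g k)
      + (θ ((N : ℤ) - k - 2) ^ 2 - θ ((N : ℤ) - k - 3) ^ 2) • g (k + 1) :=
    fun k => rfl
  have hg0 : g 0 = (1 / θ N ^ 2) • fderiv ℝ f (q 0) := rfl
  have hr0 : r 0 = (θ N ^ 2 - θ ((N : ℤ) - 2) ^ 2) • g 0 := by
    rw [hg0, smul_smul, mul_one_div]
    rfl
  -- This invariant yields `r N = ∇f(q N)`, because the index `-2` gives `θ = 0`.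
  have hrN : ∀ k ≤ N, r k + θ ((N : ℤ) - k - 2) ^ 2 • g k = fderiv ℝ f (q k) := by
    intro k
    induction k with
    | zero =>
      intro _
      have hne : θ N ^ 2 ≠ 0 := (pow_pos (hθ.pos N (by lia) le_rfl) 2).ne'
      rw [hr0, Nat.cast_zero, sub_zero, ← add_smul, sub_add_cancel, hg0, smul_smul,
        mul_one_div_cancel hne, one_smul]
    | succ k ih =>
      intro hk
      have hne : θ ((N : ℤ) - k - 1) ^ 2 ≠ 0 := by
        have := hpos (k + 1) hk
        rw [e1] at this
        positivity
      have h1 : θ ((N : ℤ) - k - 1) ^ 2 • (g (k + 1) - g k)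
          = fderiv ℝ f (q (k + 1)) - fderiv ℝ f (q k) := by
        rw [hgs, add_sub_cancel_left, smul_smul, mul_one_div_cancel hne, one_smul]
      have h2 : r (k + 1) + θ ((N : ℤ) - k - 3) ^ 2 • g (k + 1)
          = (r k + θ ((N : ℤ) - k - 2) ^ 2 • g k)
            + θ ((N : ℤ) - k - 1) ^ 2 • (g (k + 1) - g k) := by
        rw [hrs]
        module
      rw [e1, e3, h2, ih (by lia), h1, add_sub_cancel]
  -- The comparison point is the last iterate `q N`, which kills the other terms of the final
  -- energy.
  have h := dualAMD_energy_le hL hσ hc hf hΨ hΨ0 (N := N)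
    (b := fun k => θ ((N : ℤ) - k - 1) ^ 2 - θ ((N : ℤ) - k - 2) ^ 2)
    (τ := fun k => 1 / θ ((N : ℤ) - k) ^ 2) (q := q) (g := g) (r := r) (q N)
    (fun k hk => by have := hpos k hk; positivity)
    (fun k hk => by
      have := hpos (k + 1) hk
      rw [e1] at this ⊢
      have h2 := hθ.sq_le_sq_succ ((N : ℤ) - k - 1) (by lia)
      rw [sub_add_cancel] at h2
      exact one_div_le_one_div_of_le (by positivity) h2)
    (fun k hk => by
      have := hθ.sub_sq_nonneg ((N : ℤ) - k - 1) (by lia)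
      rwa [e2] at this)
    (fun k hk => by
      have := hpos (k + 1) hk
      rw [e1] at this ⊢
      have h2 := hθ.sq_sub_sq_le ((N : ℤ) - k - 1) (by lia) (by lia)
      rw [e2] at h2
      rw [mul_one_div]
      exact div_le_one_of_le₀ h2 (by positivity))
    (by simpa using hg0)
    (by simpa [← hθ.last] using hr0)
    (fun k _ => hqs k)
    (fun k _ => by rw [e1]; exact hgs k)
    (fun k _ => by rw [e1, e2, e3]; exact hrs k)
    N le_rfl
  have h1 := hrN N le_rfl
  rw [hθ.zero_of_neg ((N : ℤ) - N - 2) (by lia)] at h1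
  simp only [ne_eq, OfNat.ofNat_ne_zero, not_false_eq_true, zero_pow, zero_smul, add_zero] at h1
  rw [hθ.zero_of_neg ((N : ℤ) - N - 2) (by lia), hθ.zero_of_neg ((N : ℤ) - N - 1) (by lia)] at h
  change σ / L * Ψ (fderiv ℝ f (q N)) ≤ 1 / θ N ^ 2 * (f (q 0) - f (q N))
  simpa [h1] using h

end Bounds

end MirrorDescent

end

/-! ### The main theorem. -/

open MirrorDescent
theorem mainTheorem3 :
    ∃ C : ℝ, 0 < C ∧
      ∀ (X : Type*) [NormedAddCommGroup X] [NormedSpace ℝ X] [CompleteSpace X],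
      IsReflexiveSpace X →
      ∀ (f : X → ℝ) (φ ψ : X → EReal) (L σ₁ σ₂ : ℝ), 0 < L → 0 < σ₁ → 0 < σ₂ →
      ConvexOn ℝ Set.univ f → IsSmoothWith f L →
      IsCCP φ → IsStronglyConvex φ σ₁ →
      IsCCP ψ → IsStronglyConvex ψ σ₂ →
      -- `ψ*(0) = 0` and `0` is the unique minimizer of `ψ*`
      conj ψ 0 = 0 → (∀ u : StrongDual ℝ X, u ≠ 0 → conj ψ 0 < conj ψ u) →
      ∀ xstar : X, φ xstar < ⊤ → (∀ x, f xstar ≤ f x) →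
      ∀ (N : ℕ) (θ : ℤ → ℝ), 1 ≤ N → IsAdmissible N θ →
      ∀ (y₀ : StrongDual ℝ X) (x₀ xN x2N : X),
      x₀ = (amd f φ L σ₁ θ y₀ 0).1 →
      xN = (amd f φ L σ₁ θ y₀ N).1 →
      x2N = (dualAMD f ψ L σ₂ N θ xN N).1 →
      -- the gradients `∇φ*`, `∇ψ*` used by the methods exist everywhere
      (∀ y, HasConjGradAt φ (conjGrad φ y) y) ∧ (∀ y, HasConjGradAt ψ (conjGrad ψ y) y) ∧
      -- the dual-AMD bound
      conj ψ (fderiv ℝ f x2N)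
        ≤ ((L / (σ₂ * θ N ^ 2) * (f xN - f xstar) : ℝ) : EReal) ∧
      -- the AMD bound
      ((L / (σ₂ * θ N ^ 2) * (f xN - f xstar) : ℝ) : EReal)
        ≤ ((L ^ 2 / (σ₁ * σ₂ * θ N ^ 4) : ℝ) : EReal) * bregman φ xstar x₀ ∧
      -- the rate, for the standard choice of the parameters
      ((∀ i : ℤ, 0 ≤ i → i < N → θ i ^ 2 - θ i = θ (i - 1) ^ 2) →
        ((L ^ 2 / (σ₁ * σ₂ * θ N ^ 4) : ℝ) : EReal) * bregman φ xstar x₀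
          ≤ ((C * (L ^ 2 / (σ₁ * σ₂ * (N : ℝ) ^ 4)) : ℝ) : EReal) * bregman φ xstar x₀) := by
  -- `16 = 2⁴`, from `N ≤ 2 θ_N`.
  refine ⟨16, by norm_num, ?_⟩
  intro X _ _ _ hX f φ ψ L σ₁ σ₂ hL hσ₁ hσ₂ hc hf hφ hφs hψ hψs hψ0 _ xs hxs hmin N θ hN hθ y₀ x₀
    xN x2N hx₀ hxN hx2N
  obtain ⟨Φ, hΦ, hΦs, hΦg, hΦe⟩ := hφs.exists_conj hX hφ hσ₁
  obtain ⟨Ψ, hΨ, -, hΨg, hΨe⟩ := hψs.exists_conj hX hψ hσ₂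
  obtain ⟨p, hp⟩ := hφ.exists_coe hxs
  have hΨ0 : Ψ 0 = 0 := by
    rw [hΨ] at hψ0
    exact_mod_cast hψ0
  have hθN : 0 < θ N := hθ.pos N (by lia) le_rfl
  have hN' : (0 : ℝ) < N := by exact_mod_cast hN
  have hFY : ∀ u, u xs - p ≤ Φ u := fun u => le_of_conj_eq hp (hΦ u)
  have hD : 0 ≤ p + Φ y₀ - y₀ xs := by linarith [hFY y₀]
  -- `φ` may fail to be differentiable at `x₀`; then the divergence is `⊤` and the bounds involving
  -- it are trivial.
  have hbreg : bregman φ xs x₀ = ⊤ ∨ bregman φ xs x₀ = ((p + Φ y₀ - y₀ xs : ℝ) : EReal) := by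
    rw [hx₀]
    exact (hΦs y₀).bregman_eq hφ hp (hΦ y₀)
  have hcoef : 0 < L ^ 2 / (σ₁ * σ₂ * θ N ^ 4) := by positivity
  refine ⟨hΦg, hΨg, ?_, ?_, fun heq => ?_⟩
  · have h1 := dualAMD_conj_le hL hσ₂ hc hf hΨe hΨ0 hN hθ xN
    rw [← hx2N] at h1
    rw [hΨ, EReal.coe_le_coe_iff]
    calc Ψ (fderiv ℝ f x2N) = L / σ₂ * (σ₂ / L * Ψ (fderiv ℝ f x2N)) := by field_simp
      _ ≤ L / σ₂ * (1 / θ N ^ 2 * (f xN - f xs)) := by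
        refine mul_le_mul_of_nonneg_left (h1.trans ?_) (by positivity)
        gcongr
        exact hmin x2N
      _ = L / (σ₂ * θ N ^ 2) * (f xN - f xs) := by field_simp
  · rcases hbreg with hb | hb
    · rw [hb, EReal.coe_mul_top_of_pos hcoef]
      exact le_top
    · have h1 := amd_sub_le hL hσ₁ hc hf hΦe hθ y₀ xs hFY
      rw [← hxN] at h1
      rw [hb, ← EReal.coe_mul, EReal.coe_le_coe_iff]
      calc L / (σ₂ * θ N ^ 2) * (f xN - f xs)
          = L / (σ₂ * θ N ^ 4) * (θ N ^ 2 * (f xN - f xs)) := by field_simp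
        _ ≤ L / (σ₂ * θ N ^ 4) * (L / σ₁ * (p + Φ y₀ - y₀ xs)) := by gcongr
        _ = L ^ 2 / (σ₁ * σ₂ * θ N ^ 4) * (p + Φ y₀ - y₀ xs) := by field_simp
  · rcases hbreg with hb | hb
    · rw [hb, EReal.coe_mul_top_of_pos hcoef, EReal.coe_mul_top_of_pos (by positivity)]
    · rw [hb, ← EReal.coe_mul, ← EReal.coe_mul, EReal.coe_le_coe_iff]
      refine mul_le_mul_of_nonneg_right ?_ hD
      have h1 : (N : ℝ) ^ 4 ≤ (2 * θ N) ^ 4 :=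
        pow_le_pow_left₀ hN'.le (hθ.le_two_mul_last hN heq) 4
      rw [← mul_div_assoc, div_le_div_iff₀ (by positivity) (by positivity)]
      have h2 : 0 ≤ L ^ 2 * (σ₁ * σ₂) := by positivity
      have h3 := mul_le_mul_of_nonneg_left h1 h2
      linarith
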